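/- Let $N\ge 2$ and $0\le K<2^{N-1}$. Split the $2^N$ bit strings of length $N$ into $2^{N-1}$ pairs $\{\mathbf{k}_i,\overline{\mathbf{k}}_i\}$, where $\overline{\mathbf{k}}$ is the bitwise complement of $\mathbf{k}$, and let $\alpha_i\ge\beta_i$ be real numbers with $\alpha_i^2+\beta_i^2=1$. The $N$-qubit states $$|\psi_i^+\rangle=\alpha_i|\mathbf{k}_i\rangle+\beta_i|\overline{\mathbf{k}}_i\rangle,\qquad |\psi_i^-\rangle=\beta_i|\mathbf{k}_i\rangle-\alpha_i|\overline{\mathbf{k}}_i\rangle,\qquad i=1,\dots,2^{N-1},$$ form an orthonormal basis of conjugate pairs. Call it a hybrid basis with $K$ entangled pairs if for exactly $K$ indices $i$ the pair is entangled, i.e. $E_i=-\alpha_i^2\log_2\alpha_i^2-\beta_i^2\log_2\beta_i^2\neq 0$ (with $0\log_2 0=0$), and $\beta_i=0$ for all other $i$, so that the remaining $2^N-2K$ states are computational product states. A spatially separated configuration is a distribution of the $N$ qubits over at least two non-empty laboratories; LOCC protocols consist of finitely many rounds, in each of which one laboratory performs a quantum instrument with finitely many outcomes on its own qubits and a finite-dimensional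 local ancilla and announces the outcome to all the others. A set of states is perfectly LOCC-distinguishable in a configuration if some such protocol identifies every state of the set with probability one. For every hybrid basis with $K$ entangled pairs: (1) if $S$ is a set of states of the basis that is perfectly LOCC-distinguishable in at least one spatially separated configuration, then $|S|\le 2^N-K$; (2) this bound is tight: any set consisting of all $2^N-2K$ product states and exactly one state from each of the $K$ entangled pairs has $2^N-K$ elements, and it is perfectly LOCC-distinguishable in every spatially separated configuration (in particular when all qubits are separated from each other). -/

import Mathlib

open scoped Matrix

noncomputable section

/-! ### Multi-qubit states -/

/-- Bit strings of length `N`. -/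
abbrev BitString (N : ℕ) : Type := Fin N → Bool

/-- The bitwise complement of a bit string. -/
def BitString.compl {N : ℕ} (k : BitString N) : BitString N := fun q => !(k q)

/-- Vectors of the `N`-qubit space, by their amplitudes in the computational basis. -/
abbrev StateVector (N : ℕ) : Type := BitString N → ℂ

/-- The computational basis vector `|k⟩`. -/
def ket {N : ℕ} (k : BitString N) : StateVector N := Pi.single k 1

/-- The entanglement (in ebits) of `a|k⟩ + b|k̄⟩`, i.e. its entropy of entanglement
`-a² log₂ a² - b² log₂ b²`, with `0 log₂ 0 = 0`. -/
def pairEntanglement (a b : ℝ) : ℝ :=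
  -(a ^ 2 * Real.logb 2 (a ^ 2)) - b ^ 2 * Real.logb 2 (b ^ 2)

/-- A hybrid `N`-qubit basis with exactly `K` entangled conjugate pairs. The bit strings are split
into `2 ^ (N - 1)` complementary pairs `k i`, `(k i).compl`. The pairs in `ent` are entangled; in
the other ones `β i = 0`, so that they consist of two computational product states. -/
structure HybridBasis (N K : ℕ) where
  /-- One bit string of each complementary pair. -/
  k : Fin (2 ^ (N - 1)) → BitString N
  /-- Every bit string is `k i` or its complement in exactly one way. -/
  complete : Function.Bijective
    (fun x : Fin (2 ^ (N - 1)) × Bool => if x.2 then k x.1 else (k x.1).compl)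
  α : Fin (2 ^ (N - 1)) → ℝ
  β : Fin (2 ^ (N - 1)) → ℝ
  β_le_α : ∀ i, β i ≤ α i
  normalized : ∀ i, α i ^ 2 + β i ^ 2 = 1
  /-- The indices of the entangled conjugate pairs. -/
  ent : Finset (Fin (2 ^ (N - 1)))
  card_ent : ent.card = K
  entangled : ∀ i ∈ ent, pairEntanglement (α i) (β i) ≠ 0
  product : ∀ i, i ∉ ent → β i = 0

namespace HybridBasis

variable {N K : ℕ}

/-- The basis states: `ψᵢ⁺ = αᵢ|kᵢ⟩ + βᵢ|k̄ᵢ⟩` for the sign `true` and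
`ψᵢ⁻ = βᵢ|kᵢ⟩ - αᵢ|k̄ᵢ⟩` for the sign `false`. -/
def state (H : HybridBasis N K) (i : Fin (2 ^ (N - 1))) (s : Bool) : StateVector N :=
  if s then (H.α i : ℂ) • ket (H.k i) + (H.β i : ℂ) • ket (H.k i).compl
  else (H.β i : ℂ) • ket (H.k i) - (H.α i : ℂ) • ket (H.k i).compl

/-- The set of all states of the basis. -/
def states (H : HybridBasis N K) : Set (StateVector N) :=
  {φ | ∃ i s, φ = H.state i s}

/-- All the product states, together with the state of sign `σ i` from each entangled
conjugate pair `i`. -/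
def productsAndOneOfEachPair (H : HybridBasis N K) (σ : Fin (2 ^ (N - 1)) → Bool) :
    Set (StateVector N) :=
  {φ | ∃ i s, (i ∈ H.ent → s = σ i) ∧ φ = H.state i s}

end HybridBasis

/-! ### Local operations and classical communication -/

/-- A quantum instrument on a finite-dimensional system with orthonormal basis `ι`: finitely many
classical outcomes `x`, each with the completely positive map `ρ ↦ ∑ j, K x j * ρ * (K x j)ᴴ`,
whose sum is trace preserving. -/
structure Instrument (ι : Type) [Fintype ι] [DecidableEq ι] where
  outcomes : ℕ
  krausCount : ℕ
  kraus : Fin outcomes → Fin krausCount → Matrix ι ι ℂ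
  complete : ∑ x, ∑ j, (kraus x j)ᴴ * kraus x j = 1

section Protocols

variable {P : Type} [Fintype P] [DecidableEq P] (d : P → Type)
  [∀ p, Fintype (d p)] [∀ p, DecidableEq (d p)]

/-- LOCC protocols (with finitely many rounds) for parties `P` holding local systems with bases
`d p`, which end with a guess in `G`. In each round a party performs an instrument on its own
system and announces the outcome; the continuation may depend on all announced outcomes. -/
inductive LOCCProtocol (G : Type) : Type
  | guess (g : G) : LOCCProtocol G
  | measure (p : P) (I : Instrument (d p)) (next : Fin I.outcomes → LOCCProtocol G) :
      LOCCProtocol G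

variable {d}

/-- The operator `A ⊗ 1` on the joint system, where `A` acts on the system of party `p`. -/
def localOp (p : P) (A : Matrix (d p) (d p) ℂ) : Matrix (∀ q, d q) (∀ q, d q) ℂ :=
  Matrix.of fun y x => if ∀ q, q ≠ p → y q = x q then A (y p) (x p) else 0

open Classical in
/-- The probability that the protocol, applied to the joint state `ρ` (a density matrix; a
subnormalized one for the later rounds, so that branch probabilities are accounted for), ends with
the guess `g`. -/
def LOCCProtocol.prob {G : Type} :
    LOCCProtocol d G → Matrix (∀ q, d q) (∀ q, d q) ℂ → G → ℂ
  | .guess g', ρ, g => if g' = g then ρ.trace else 0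
  | .measure p I next, ρ, g =>
      ∑ x, (next x).prob (∑ j, localOp p (I.kraus x j) * ρ * (localOp p (I.kraus x j))ᴴ) g

end Protocols

/-! ### Spatial configurations and perfect distinguishability -/

/-- A spatially separated configuration of `N` qubits: they are distributed over at least two
laboratories, none of which is empty. Qubits in the same laboratory can be operated on
collectively. -/
structure SpatialConfiguration (N : ℕ) where
  labs : ℕ
  two_le_labs : 2 ≤ labs
  lab : Fin N → Fin labs
  lab_surjective : Function.Surjective lab

namespace SpatialConfiguration

variable {N : ℕ}

/-- The basis of the local system of laboratory `p`: bit strings for the qubits located there, and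
the basis of a local ancilla of arbitrary finite dimension `a p + 1`. -/
abbrev LocalIndex (C : SpatialConfiguration N) (a : Fin C.labs → ℕ) (p : Fin C.labs) : Type :=
  ({q : Fin N // C.lab q = p} → Bool) × Fin (a p + 1)

/-- The `N`-qubit vector `ψ`, distributed over the laboratories, with every ancilla in the
state `|0⟩`. -/
def distribute (C : SpatialConfiguration N) (a : Fin C.labs → ℕ) (ψ : StateVector N) :
    (∀ p, C.LocalIndex a p) → ℂ :=
  fun x => if ∀ p, (x p).2 = 0 then ψ (fun q => (x (C.lab q)).1 ⟨q, rfl⟩) else 0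

end SpatialConfiguration

/-- A set `S` of states is perfectly LOCC-distinguishable in the configuration `C`: some LOCC
protocol between the laboratories identifies every state of `S` with probability one. -/
def PerfectlyLOCCDistinguishable {N : ℕ} (C : SpatialConfiguration N)
    (S : Set (StateVector N)) : Prop :=
  ∃ (a : Fin C.labs → ℕ) (T : LOCCProtocol (C.LocalIndex a) (StateVector N)),
    ∀ φ ∈ S,
      T.prob (Matrix.vecMulVec (C.distribute a φ) (star (C.distribute a φ))) φ = 1

end

/-! Upper bound: pulled back to the initial state, an LOCC protocol is a resolution of the identity
by rank-one operators given by functionals `h l` that factor over the laboratories, each labelled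
with a guess. If `k'` arises from `k` by flipping all bits of one laboratory, the factorization
gives `h(k) h(k̄) = h(k') h(k̄')`. This quantity links an entangled pair `i` to its partner pair
`j`.

Suppose both states of `i` lie in `S`. A functional guessing neither of them annihilates both, so
its product is 0. One that detects `ψᵢ⁺` annihilates `ψᵢ⁻`; as `αᵢ` and `βᵢ` are nonzero, its
product is nonzero. If a state `χ` of `j` were also in `S`, the functionals guessing `χ` would have
product 0, which forces them to account for all of some `|m⟩` of the pair `j`
(`apply_eq_zero_of_guess_ne`). All other functionals then vanish at `m`, contradicting the nonzero
product (`state_flipPair_notMem`).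

So an entangled pair wholly in `S` has a partner wholly outside `S`. Partnership is an involution
without fixed points, and counting over it gives `|S| + K ≤ 2^N`.

Tightness: the measured bits reveal the pair, and for product pairs also the sign. -/

noncomputable section

/-! ### LOCC protocols as resolutions of the identity by product functionals -/

section LocalOperators

variable {P : Type} [Fintype P] [DecidableEq P] {d : P → Type}
  [∀ p, Fintype (d p)] [∀ p, DecidableEq (d p)]

/-- The product vector `⊗ₚ F p`. -/
def productVector (F : ∀ p, d p → ℂ) : (∀ p, d p) → ℂ := fun x => ∏ p, F p (x p)

omit [Fintype P] [∀ p, Fintype (d p)] [∀ p, DecidableEq (d p)] in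
lemma update_eq_of_eq_off {p : P} {x y : ∀ q, d q} (h : ∀ q, q ≠ p → y q = x q) :
    Function.update x p (y p) = y := by
  funext q
  by_cases hq : q = p
  · subst hq; simp
  · simp [hq, h q hq]

lemma sum_ite_eq_off (p : P) (x : ∀ q, d q) (f : (∀ q, d q) → ℂ) :
    (∑ y, if ∀ q, q ≠ p → y q = x q then f y else 0) =
      ∑ z, f (Function.update x p z) := by
  rw [← Finset.sum_filter]
  refine (Finset.sum_bij' (fun z _ => Function.update x p z) (fun y _ => y p) ?_ ?_ ?_ ?_ ?_).symm
  · intro z _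
    simp +contextual
  · simp
  · simp
  · intro y hy
    exact update_eq_of_eq_off (Finset.mem_filter.1 hy).2
  · simp

/-- A local Kraus operator, moved from the state onto the functional, changes a single factor; hence
product form survives every round. -/
lemma productVector_vecMul_localOp (F : ∀ p, d p → ℂ) (p : P) (A : Matrix (d p) (d p) ℂ) :
    productVector F ᵥ* localOp p A =
      productVector (Function.update F p (F p ᵥ* A)) := by
  funext x
  simp only [Matrix.vecMul, dotProduct, localOp, Matrix.of_apply, mul_ite, mul_zero]
  rw [sum_ite_eq_off p x (fun y => productVector F y * A (y p) (x p))]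
  simp only [productVector, ← Finset.mul_prod_erase Finset.univ _ (Finset.mem_univ p),
    Function.update_self, Matrix.vecMul, dotProduct, Finset.sum_mul]
  refine Finset.sum_congr rfl fun z _ => ?_
  have h1 : ∏ q ∈ Finset.univ.erase p, F q (Function.update x p z q) =
      ∏ q ∈ Finset.univ.erase p, F q (x q) :=
    Finset.prod_congr rfl fun q hq => by
      rw [Function.update_of_ne (Finset.ne_of_mem_erase hq)]
  have h2 : ∏ q ∈ Finset.univ.erase p,
      Function.update F p (F p ᵥ* A) q (x q) =
      ∏ q ∈ Finset.univ.erase p, F q (x q) :=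
    Finset.prod_congr rfl fun q hq => by
      rw [Function.update_of_ne (Finset.ne_of_mem_erase hq)]
  rw [h1]
  rw [h2]
  ring

omit [∀ p, Fintype (d p)] in
lemma localOp_one (p : P) : localOp p (1 : Matrix (d p) (d p) ℂ) = 1 := by
  ext y x
  simp only [localOp, Matrix.of_apply, Matrix.one_apply]
  by_cases h : y = x
  · subst h; simp
  · rw [if_neg h]
    split_ifs with h1 h2
    · refine absurd (funext fun q => ?_) h
      by_cases hq : q = p
      · subst hq; exact h2
      · exact h1 q hq
    all_goals rfl

lemma localOp_conjTranspose_mul_localOp (p : P) (A B : Matrix (d p) (d p) ℂ) :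
    (localOp p A)ᴴ * localOp p B = localOp p (Aᴴ * B) := by
  ext y x
  simp only [localOp, Matrix.mul_apply, Matrix.conjTranspose_apply, Matrix.of_apply, mul_ite,
    mul_zero]
  rw [sum_ite_eq_off p x (fun w => star (if ∀ q, q ≠ p → w q = y q then A (w p) (y p) else 0) *
    B (w p) (x p))]
  simp only [Function.update_self]
  have h (z : d p) : (∀ q, q ≠ p → Function.update x p z q = y q) ↔ ∀ q, q ≠ p → y q = x q := by
    refine forall_congr' fun q => imp_congr_right fun hq => ?_
    rw [Function.update_of_ne hq]
    exact eq_comm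
  simp only [h]
  split_ifs <;> simp

omit [∀ p, Fintype (d p)] in
lemma localOp_sum {ι : Type*} (s : Finset ι)
    (p : P) (A : ι → Matrix (d p) (d p) ℂ) :
    localOp p (∑ i ∈ s, A i) = ∑ i ∈ s, localOp p (A i) := by
  ext y x
  simp only [localOp, Matrix.sum_apply, Matrix.of_apply]
  split_ifs <;> simp

lemma Instrument.sum_trace_localOp {p : P} (I : Instrument (d p))
    (ρ : Matrix (∀ q, d q) (∀ q, d q) ℂ) :
    ∑ x, (∑ j, localOp p (I.kraus x j) * ρ * (localOp p (I.kraus x j))ᴴ).trace = ρ.trace := by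
  have h : ∑ x, ∑ j, (localOp p (I.kraus x j))ᴴ * localOp p (I.kraus x j) = 1 := by
    simp only [localOp_conjTranspose_mul_localOp, ← localOp_sum, I.complete, localOp_one]
  calc _ = (∑ x, ∑ j, (localOp p (I.kraus x j))ᴴ * localOp p (I.kraus x j) * ρ).trace := by
        simp only [Matrix.trace_sum]
        refine Finset.sum_congr rfl fun x _ => Finset.sum_congr rfl fun j _ => ?_
        rw [Matrix.trace_mul_comm, ← Matrix.mul_assoc]
    _ = ρ.trace := by
        simp only [← Matrix.sum_mul, h, Matrix.one_mul]

open Classical in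
/-- Every outcome probability of an LOCC protocol is a sum of expectation values of rank-one
product operators, which together resolve the identity. -/
theorem LOCCProtocol.exists_productVectors {G : Type} (T : LOCCProtocol d G) :
    ∃ (L : Type) (_ : Fintype L) (g : L → G) (F : L → ∀ p, d p → ℂ),
      (∀ ρ g', T.prob ρ g' = ∑ l, if g l = g' then
        productVector (F l) ⬝ᵥ ρ *ᵥ star (productVector (F l)) else 0) ∧
      ∀ ρ, ∑ l, productVector (F l) ⬝ᵥ ρ *ᵥ star (productVector (F l)) = ρ.trace := by
  induction T with
  | guess g =>
    -- At a leaf the probability is a trace, which is the sum over computational basis vectors;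
    -- these are product vectors.
    have key (y : ∀ p, d p) : productVector (fun p => Pi.single (y p) (1 : ℂ)) = Pi.single y 1 := by
      funext x
      simp only [productVector, Pi.single_apply]
      by_cases h : x = y
      · subst h; simp
      · obtain ⟨p, hp⟩ := Function.ne_iff.1 h
        rw [if_neg h]
        exact Finset.prod_eq_zero (Finset.mem_univ p) (if_neg hp)
    have key2 (ρ : Matrix (∀ q, d q) (∀ q, d q) ℂ) (y : ∀ q, d q) :
        (Pi.single y (1 : ℂ)) ⬝ᵥ ρ *ᵥ star (Pi.single y (1 : ℂ)) = ρ y y := by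
      rw [← Pi.single_star]; simp
    refine ⟨∀ p, d p, inferInstance, fun _ => g, fun y p => Pi.single (y p) 1, ?_, ?_⟩
    · intro ρ g'
      simp only [key, key2, LOCCProtocol.prob]
      split_ifs
      · rfl
      · simp
    · intro ρ
      simp only [key, key2]
      rfl
  | measure p I next ih =>
    choose L hL g F h1 h2 using ih
    have conj (x : Fin I.outcomes) (l : L x) (ρ : Matrix (∀ q, d q) (∀ q, d q) ℂ) :
        productVector (F x l) ⬝ᵥ (∑ j, localOp p (I.kraus x j) * ρ * (localOp p (I.kraus x j))ᴴ) *ᵥ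
          star (productVector (F x l)) =
        ∑ j, productVector (Function.update (F x l) p (F x l p ᵥ* I.kraus x j)) ⬝ᵥ ρ *ᵥ
          star (productVector (Function.update (F x l) p (F x l p ᵥ* I.kraus x j))) := by
      rw [Matrix.sum_mulVec, dotProduct_sum]
      refine Finset.sum_congr rfl fun j _ => ?_
      rw [← productVector_vecMul_localOp, Matrix.star_vecMul, ← Matrix.dotProduct_mulVec,
        Matrix.mulVec_mulVec, Matrix.mulVec_mulVec]
    -- A functional is indexed by the outcome of this round, a functional of the continuation, and
    -- the Kraus operator applied.
    refine ⟨Σ x, L x × Fin (I.krausCount), inferInstance, fun l => g l.1 l.2.1,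
      fun l => Function.update (F l.1 l.2.1) p (F l.1 l.2.1 p ᵥ* I.kraus l.1 l.2.2), ?_, ?_⟩
    · intro ρ g'
      simp only [LOCCProtocol.prob, h1, conj, Fintype.sum_sigma, Fintype.sum_prod_type]
      refine Finset.sum_congr rfl fun x _ => Finset.sum_congr rfl fun l _ => ?_
      split_ifs <;> simp
    · intro ρ
      simp only [Fintype.sum_sigma, Fintype.sum_prod_type, ← conj, h2, I.sum_trace_localOp]

/-! ### Measuring every laboratory in its basis -/

/-- The projective measurement of a local system in its basis. -/
def Instrument.basisMeasurement (ι : Type) [Fintype ι] [DecidableEq ι] : Instrument ι where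
  outcomes := Fintype.card ι
  krausCount := 1
  kraus x _ := Matrix.single ((Fintype.equivFin ι).symm x) ((Fintype.equivFin ι).symm x) 1
  complete := by
    simp only [Matrix.conjTranspose_single, star_one, Matrix.single_mul_single_same, mul_one,
      Finset.univ_unique, Finset.sum_const, Finset.card_singleton, one_smul]
    rw [Equiv.sum_comp (Fintype.equivFin ι).symm (fun i => Matrix.single i i (1 : ℂ))]
    exact Matrix.sum_single_one

/-- The listed parties measure their systems in the basis one after the other, and the guess is
a function of the results (of `acc` for the other parties). -/
def LOCCProtocol.measureAll {G : Type} (guess : (∀ p, d p) → G) :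
    List P → (∀ p, d p) → LOCCProtocol d G
  | [], acc => .guess (guess acc)
  | p :: l, acc => .measure p (Instrument.basisMeasurement (d p)) fun x =>
      measureAll guess l (Function.update acc p ((Fintype.equivFin (d p)).symm x))

omit [∀ p, Fintype (d p)] in
lemma localOp_single_self (p : P) (o : d p) :
    localOp p (Matrix.single o o (1 : ℂ)) =
      Matrix.diagonal fun x : ∀ q, d q => if x p = o then 1 else 0 := by
  ext y x
  simp only [localOp, Matrix.of_apply, Matrix.single_apply, Matrix.diagonal_apply]
  by_cases h : y = x
  · subst h; simp [eq_comm]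
  · rw [if_neg h]
    split_ifs with h1 h2
    · refine absurd (funext fun q => ?_) h
      by_cases hq : q = p
      · subst hq; exact h2.1.symm.trans h2.2
      · exact h1 q hq
    all_goals rfl

open Classical in
lemma LOCCProtocol.prob_measureAll {G : Type} (guess : (∀ p, d p) → G) (l : List P)
    (acc : ∀ p, d p) (ρ : Matrix (∀ q, d q) (∀ q, d q) ℂ) (g : G) :
    (measureAll guess l acc).prob ρ g =
      ∑ x, if guess (fun p => if p ∈ l then x p else acc p) = g then ρ x x else 0 := by
  induction l generalizing acc ρ with
  | nil =>
    simp only [measureAll, LOCCProtocol.prob, List.not_mem_nil, if_false]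
    split_ifs
    · rfl
    · simp
  | cons p l ih =>
    simp only [measureAll, LOCCProtocol.prob, ih, Instrument.basisMeasurement, Finset.univ_unique,
      Finset.sum_singleton, localOp_single_self, Matrix.diagonal_conjTranspose,
      Matrix.mul_diagonal, Matrix.diagonal_mul]
    rw [Equiv.sum_comp (Fintype.equivFin (d p)).symm (fun o => ∑ x : ∀ q, d q,
      if guess (fun q => if q ∈ l then x q else Function.update acc p o q) = g then
        (if x p = o then 1 else 0) * ρ x x *
          star (fun x : ∀ q, d q => if x p = o then (1 : ℂ) else 0) x else 0), Finset.sum_comm]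
    refine Finset.sum_congr rfl fun x _ => ?_
    rw [Finset.sum_eq_single (x p)]
    · have : (fun q => if q ∈ l then x q else Function.update acc p (x p) q) =
          fun q => if q ∈ p :: l then x q else acc q := by
        funext q
        by_cases hq : q = p
        · subst hq; simp
        · simp [hq]
      rw [this]
      simp
    · intro o _ ho
      simp [ho.symm]
    · simp

end LocalOperators

/-! ### Bit flips in one laboratory, and the embedding of the qubits -/

namespace BitString

variable {N : ℕ}

lemma compl_compl (k : BitString N) : k.compl.compl = k := by
  funext q; simp [BitString.compl]

end BitString

namespace SpatialConfiguration

variable {N : ℕ} (C : SpatialConfiguration N)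

/-- The bit string `k` with the bits in laboratory `p` flipped. -/
def flip (p : Fin C.labs) (k : BitString N) : BitString N :=
  fun q => if C.lab q = p then !k q else k q

lemma flip_flip (p : Fin C.labs) (k : BitString N) : C.flip p (C.flip p k) = k := by
  funext q; by_cases h : C.lab q = p <;> simp [flip, h]

lemma flip_compl (p : Fin C.labs) (k : BitString N) : C.flip p k.compl = (C.flip p k).compl := by
  funext q; by_cases h : C.lab q = p <;> simp [flip, BitString.compl, h]

lemma flip_ne (p : Fin C.labs) (k : BitString N) : C.flip p k ≠ k := fun h => by
  obtain ⟨q, hq⟩ := C.lab_surjective p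
  have := congrFun h q
  simp [flip, hq] at this

lemma flip_ne_compl (p : Fin C.labs) (k : BitString N) : C.flip p k ≠ k.compl := fun h => by
  have : Nontrivial (Fin C.labs) := Fin.nontrivial_iff_two_le.2 C.two_le_labs
  obtain ⟨p', hp⟩ := exists_ne p
  obtain ⟨q, hq⟩ := C.lab_surjective p'
  have := congrFun h q
  simp [flip, hq, hp, BitString.compl] at this

/-- The index of the basis vector `|k⟩` of the joint system, with every ancilla in `|0⟩`. -/
def embed (a : Fin C.labs → ℕ) (k : BitString N) : ∀ p, C.LocalIndex a p :=
  fun _ => (fun q => k q, 0)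

/-- The bits of the qubits in a basis vector of the joint system. -/
def bits {a : Fin C.labs → ℕ} (x : ∀ p, C.LocalIndex a p) : BitString N :=
  fun q => (x (C.lab q)).1 ⟨q, rfl⟩

lemma bits_embed (a : Fin C.labs → ℕ) (k : BitString N) : C.bits (C.embed a k) = k := rfl

lemma embed_bits {a : Fin C.labs → ℕ} {x : ∀ p, C.LocalIndex a p} (h : ∀ p, (x p).2 = 0) :
    C.embed a (C.bits x) = x := by
  funext p
  refine Prod.ext (funext fun q => ?_) (h p).symm
  obtain ⟨q, rfl⟩ := q
  rfl

lemma distribute_embed (a : Fin C.labs → ℕ) (ψ : StateVector N) (k : BitString N) :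
    C.distribute a ψ (C.embed a k) = ψ k := by
  simp [distribute, embed]

/-- Ancillas start in `|0⟩`, so their other levels never contribute and sums reduce to bit strings.
-/
lemma sum_eq_sum_embed {a : Fin C.labs → ℕ} (f : (∀ p, C.LocalIndex a p) → ℂ)
    (hf : ∀ x, (¬ ∀ p, (x p).2 = 0) → f x = 0) : ∑ x, f x = ∑ k, f (C.embed a k) := by
  symm
  refine Finset.sum_of_injOn (C.embed a) ?_ (by simp) ?_ (by simp)
  · intro k _ k' _ h
    simpa only [bits_embed] using congrArg C.bits h
  · intro x _ hx
    refine hf x fun h => hx ?_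
    exact ⟨C.bits x, by simp, C.embed_bits h⟩

lemma dotProduct_distribute {a : Fin C.labs → ℕ} (f : (∀ p, C.LocalIndex a p) → ℂ)
    (ψ : StateVector N) :
    f ⬝ᵥ C.distribute a ψ = (fun k => f (C.embed a k)) ⬝ᵥ ψ := by
  simp only [dotProduct]
  rw [C.sum_eq_sum_embed]
  · simp only [distribute_embed]
  · intro x hx
    simp [distribute, hx]

end SpatialConfiguration

/-! ### Functionals of a perfectly distinguishing protocol -/

lemma dotProduct_vecMulVec_mulVec_star {n : Type*} [Fintype n] (f v w : n → ℂ) :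
    f ⬝ᵥ Matrix.vecMulVec v (star w) *ᵥ star f = (f ⬝ᵥ v) * star (f ⬝ᵥ w) := by
  rw [Matrix.dotProduct_mulVec, Matrix.vecMul_vecMulVec, smul_dotProduct, smul_eq_mul,
    Matrix.star_dotProduct_star]

open Classical in
/-- In a perfectly distinguishing protocol, the guess is made according to a resolution of the
identity by functionals which are products over the laboratories. -/
theorem PerfectlyLOCCDistinguishable.exists_functionals {N : ℕ} {C : SpatialConfiguration N}
    {S : Set (StateVector N)} (hS : PerfectlyLOCCDistinguishable C S) :
    ∃ (L : Type) (_ : Fintype L) (g : L → StateVector N) (h : L → StateVector N),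
      (∀ l p k, h l k * h l k.compl = h l (C.flip p k) * h l (C.flip p k).compl) ∧
      (∀ v w, ∑ l, (h l ⬝ᵥ v) * star (h l ⬝ᵥ w) = v ⬝ᵥ star w) ∧
      ∀ φ ∈ S, (∑ l, if g l = φ then (h l ⬝ᵥ φ) * star (h l ⬝ᵥ φ) else 0) = 1 := by
  obtain ⟨a, T, hT⟩ := hS
  obtain ⟨L, _, g, F, h1, h2⟩ := T.exists_productVectors
  refine ⟨L, inferInstance, g, fun l k => productVector (F l) (C.embed a k), ?_, ?_, ?_⟩
  · intro l p k
    simp only [productVector, ← Finset.prod_mul_distrib]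
    refine Finset.prod_congr rfl fun p' _ => ?_
    -- In laboratory `p` the flip exchanges the factors of `k` and its complement; elsewhere both
    -- are unchanged.
    by_cases hp : p' = p
    · have e1 : C.embed a (C.flip p k) p' = C.embed a k.compl p' := by
        refine Prod.ext (funext fun q => ?_) rfl
        simp [SpatialConfiguration.embed, SpatialConfiguration.flip, BitString.compl, q.2, hp]
      have e2 : C.embed a (C.flip p k).compl p' = C.embed a k p' := by
        refine Prod.ext (funext fun q => ?_) rfl
        simp [SpatialConfiguration.embed, SpatialConfiguration.flip, BitString.compl, q.2, hp]
      rw [e1, e2, mul_comm]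
    · have e1 : C.embed a (C.flip p k) p' = C.embed a k p' := by
        refine Prod.ext (funext fun q => ?_) rfl
        simp [SpatialConfiguration.embed, SpatialConfiguration.flip, q.2, hp]
      have e2 : C.embed a (C.flip p k).compl p' = C.embed a k.compl p' := by
        refine Prod.ext (funext fun q => ?_) rfl
        simp [SpatialConfiguration.embed, SpatialConfiguration.flip, BitString.compl, q.2, hp]
      rw [e1, e2]
  · intro v w
    -- The trace identity holds for every matrix, so `|v⟩⟨w|` gives the polarized form.
    have := h2 (Matrix.vecMulVec (C.distribute a v) (star (C.distribute a w)))
    simp only [dotProduct_vecMulVec_mulVec_star, C.dotProduct_distribute,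
      Matrix.trace_vecMulVec] at this
    rw [this]
    simp only [dotProduct]
    rw [C.sum_eq_sum_embed]
    · simp only [Pi.star_apply, C.distribute_embed]
    · intro x hx
      simp [SpatialConfiguration.distribute, hx]
  · intro φ hφ
    have := hT φ hφ
    rw [h1] at this
    simpa only [dotProduct_vecMulVec_mulVec_star, C.dotProduct_distribute] using this

/-- The terms are `|c l|²`, so those omitted from a subsum equal to the total must vanish. -/
lemma eq_zero_of_sum_ite_eq_sum {L : Type*} [Fintype L] {c : L → ℂ} {p : L → Prop}
    [DecidablePred p]
    (h : (∑ l, if p l then c l * star (c l) else 0) = ∑ l, c l * star (c l))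
    (l : L) (hl : ¬ p l) : c l = 0 := by
  have hsum : ∑ l, (if p l then 0 else Complex.normSq (c l)) = 0 := by
    have : ∑ l, (c l * star (c l) - if p l then c l * star (c l) else 0) = 0 := by
      rw [Finset.sum_sub_distrib, h, sub_self]
    rw [← Complex.ofReal_inj, Complex.ofReal_sum, Complex.ofReal_zero, ← this]
    refine Finset.sum_congr rfl fun l _ => ?_
    split_ifs
    · simp
    · rw [sub_zero]; exact (Complex.mul_conj _).symm
  have := (Finset.sum_eq_zero_iff_of_nonneg (fun l _ => by
    split_ifs; exacts [le_rfl, Complex.normSq_nonneg _])).1 hsum l (Finset.mem_univ l)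
  rw [if_neg hl] at this
  exact Complex.normSq_eq_zero.1 this

open Classical in
/-- If a part of a resolution of the identity contributes all of `χ` in the matrix element with
`|m⟩`, and does not connect `|m⟩` to the rest of `χ`, then it contributes all of `|m⟩`. -/
lemma apply_eq_zero_of_guess_ne {N : ℕ} {L : Type} [Fintype L] {g h : L → StateVector N}
    (hid : ∀ v w, ∑ l, (h l ⬝ᵥ v) * star (h l ⬝ᵥ w) = v ⬝ᵥ star w) {χ : StateVector N}
    (hχ : ∀ l, g l ≠ χ → h l ⬝ᵥ χ = 0) {m m' : BitString N} (hm : m' ≠ m) {x y : ℂ}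
    (hxy : χ = x • ket m + y • ket m') (hx : x ≠ 0)
    (h0 : ∀ l, g l = χ → h l m * h l m' = 0) (l : L) (hl : g l ≠ χ) : h l m = 0 := by
  have e1 := hid χ (ket m)
  have e2 := hid (ket m) (ket m)
  have hket (l) : h l ⬝ᵥ ket m = h l m := by simp [ket]
  have hdot (l) : h l ⬝ᵥ χ = x * h l m + y * h l m' := by
    rw [hxy]; simp [ket, dotProduct_add]
  have r1 : χ ⬝ᵥ star (ket m) = x := by
    rw [hxy, ket, ← Pi.single_star]; simp [ket, hm.symm]
  have r2 : ket m ⬝ᵥ star (ket m) = 1 := by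
    rw [ket, ← Pi.single_star]; simp
  -- Other guesses annihilate `χ`; for the guess `χ`, `h0` kills the cross term with `m'`.
  have e3 : ∑ l, (h l ⬝ᵥ χ) * star (h l ⬝ᵥ ket m) =
      x * ∑ l, if g l = χ then h l m * star (h l m) else 0 := by
    rw [Finset.mul_sum]
    refine Finset.sum_congr rfl fun l _ => ?_
    split_ifs with hl
    · rw [hket, hdot]
      rcases mul_eq_zero.1 (h0 l hl) with h | h <;> simp [h, mul_assoc]
    · simp [hχ l hl]
  rw [e3, r1] at e1
  have e4 : (∑ l, if g l = χ then h l m * star (h l m) else 0) = 1 :=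
    mul_left_cancel₀ hx (e1.trans (mul_one x).symm)
  rw [r2] at e2
  simp only [hket] at e2
  exact eq_zero_of_sum_ite_eq_sum (c := fun l => h l m) (p := fun l => g l = χ)
    (e4.trans e2.symm) l hl

open Classical in
/-- Functionals whose guess is not `φ` vanish on `φ`, if `φ` is always identified. -/
lemma dotProduct_eq_zero_of_guess_ne {N : ℕ} {L : Type} [Fintype L] {g h : L → StateVector N}
    {φ : StateVector N} (htot : ∑ l, (h l ⬝ᵥ φ) * star (h l ⬝ᵥ φ) = 1)
    (hφ : (∑ l, if g l = φ then (h l ⬝ᵥ φ) * star (h l ⬝ᵥ φ) else 0) = 1)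
    (l : L) (hl : g l ≠ φ) : h l ⬝ᵥ φ = 0 :=
  eq_zero_of_sum_ite_eq_sum (c := fun l => h l ⬝ᵥ φ) (p := fun l => g l = φ)
    (hφ.trans htot.symm) l hl

/-! ### Pairs and states of a hybrid basis -/

namespace HybridBasis

variable {N K : ℕ} (H : HybridBasis N K)

/-- Every bit string is one of the two strings of exactly one pair. -/
def pairEquiv : Fin (2 ^ (N - 1)) × Bool ≃ BitString N := Equiv.ofBijective _ H.complete

lemma pairEquiv_apply (i : Fin (2 ^ (N - 1))) (b : Bool) :
    H.pairEquiv (i, b) = if b then H.k i else (H.k i).compl := rfl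

/-- The index of the pair of a bit string. -/
def pairIndex (k : BitString N) : Fin (2 ^ (N - 1)) := (H.pairEquiv.symm k).1

lemma pairIndex_k (i : Fin (2 ^ (N - 1))) : H.pairIndex (H.k i) = i := by
  have : H.k i = H.pairEquiv (i, true) := rfl
  rw [pairIndex, this, Equiv.symm_apply_apply]

lemma pairIndex_k_compl (i : Fin (2 ^ (N - 1))) : H.pairIndex (H.k i).compl = i := by
  have : (H.k i).compl = H.pairEquiv (i, false) := rfl
  rw [pairIndex, this, Equiv.symm_apply_apply]

lemma eq_k_or_eq_compl (k : BitString N) :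
    k = H.k (H.pairIndex k) ∨ k = (H.k (H.pairIndex k)).compl := by
  have h : H.pairEquiv ((H.pairEquiv.symm k).1, (H.pairEquiv.symm k).2) = k :=
    H.pairEquiv.apply_symm_apply k
  rw [pairEquiv_apply] at h
  split_ifs at h
  · exact Or.inl h.symm
  · exact Or.inr h.symm

lemma pairIndex_compl (k : BitString N) : H.pairIndex k.compl = H.pairIndex k := by
  rcases H.eq_k_or_eq_compl k with h | h <;> rw [h]
  · rw [pairIndex_k_compl, pairIndex_k]
  · rw [BitString.compl_compl, pairIndex_k_compl, pairIndex_k]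

lemma k_compl_ne (i : Fin (2 ^ (N - 1))) : (H.k i).compl ≠ H.k i := fun h => by
  have : H.pairEquiv (i, false) = H.pairEquiv (i, true) := h
  simpa using H.pairEquiv.injective this

lemma dotProduct_state (f : StateVector N) (i : Fin (2 ^ (N - 1))) (s : Bool) :
    f ⬝ᵥ H.state i s = if s then H.α i * f (H.k i) + H.β i * f (H.k i).compl
      else H.β i * f (H.k i) - H.α i * f (H.k i).compl := by
  cases s <;> simp [state, ket, dotProduct_add, dotProduct_sub]

lemma state_apply_k (i : Fin (2 ^ (N - 1))) (s : Bool) :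
    H.state i s (H.k i) = if s then (H.α i : ℂ) else H.β i := by
  cases s <;> simp [state, ket, (H.k_compl_ne i).symm]

lemma state_apply_k_compl (i : Fin (2 ^ (N - 1))) (s : Bool) :
    H.state i s (H.k i).compl = if s then (H.β i : ℂ) else -H.α i := by
  cases s <;> simp [state, ket, H.k_compl_ne i]

lemma state_apply_of_pairIndex_ne {i : Fin (2 ^ (N - 1))} {k : BitString N}
    (h : H.pairIndex k ≠ i) (s : Bool) : H.state i s k = 0 := by
  have h1 : k ≠ H.k i := by rintro rfl; exact h (H.pairIndex_k i)
  have h2 : k ≠ (H.k i).compl := by rintro rfl; exact h (H.pairIndex_k_compl i)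
  cases s <;> simp [state, ket, h1, h2]

lemma dotProduct_star_state (i : Fin (2 ^ (N - 1))) (s : Bool) :
    H.state i s ⬝ᵥ star (H.state i s) = 1 := by
  have h : ((H.α i : ℂ)) ^ 2 + (H.β i : ℂ) ^ 2 = 1 := by exact_mod_cast H.normalized i
  rw [dotProduct_comm, dotProduct_state]
  simp only [Pi.star_apply, state_apply_k, state_apply_k_compl]
  cases s <;> simp <;> linear_combination h

lemma state_injective : Function.Injective fun x : Fin (2 ^ (N - 1)) × Bool => H.state x.1 x.2 := by
  rintro ⟨i, s⟩ ⟨j, t⟩ h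
  simp only at h
  have hn := H.dotProduct_star_state i s
  have hij : i = j := by
    by_contra hij
    rw [dotProduct_comm, dotProduct_state, h] at hn
    simp only [Pi.star_apply] at hn
    rw [H.state_apply_of_pairIndex_ne (by rwa [H.pairIndex_k]),
      H.state_apply_of_pairIndex_ne (by rwa [H.pairIndex_k_compl])] at hn
    simp at hn
  subst hij
  by_contra hst
  have hst : s ≠ t := fun e => hst (by rw [e])
  have e1 := congrFun h (H.k i)
  have e2 := congrFun h (H.k i).compl
  rw [state_apply_k, state_apply_k] at e1
  rw [state_apply_k_compl, state_apply_k_compl] at e2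
  have hab : H.α i = H.β i ∧ H.β i = -H.α i := by
    cases s <;> cases t <;> simp at hst e1 e2
    · exact ⟨by exact_mod_cast e1.symm, by exact_mod_cast e2.symm⟩
    · exact ⟨by exact_mod_cast e1, by exact_mod_cast e2⟩
  have := H.normalized i
  nlinarith

lemma state_inj {i j : Fin (2 ^ (N - 1))} {s t : Bool} (h : H.state i s = H.state j t) :
    (i, s) = (j, t) := H.state_injective h

lemma ncard_eq_of_states {S : Set (StateVector N)} (hS : S ⊆ H.states) :
    S.ncard = {x : Fin (2 ^ (N - 1)) × Bool | H.state x.1 x.2 ∈ S}.ncard := by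
  rw [← Set.ncard_image_of_injective _ H.state_injective]
  congr 1
  ext φ
  constructor
  · intro hφ
    obtain ⟨i, s, rfl⟩ := hS hφ
    exact ⟨(i, s), hφ, rfl⟩
  · rintro ⟨x, hx, rfl⟩
    exact hx

lemma α_ne_zero_and_β_ne_zero {i : Fin (2 ^ (N - 1))} (hi : i ∈ H.ent) :
    H.α i ≠ 0 ∧ H.β i ≠ 0 := by
  have hE := H.entangled i hi
  have hn := H.normalized i
  constructor <;> intro h0 <;> apply hE
  · have : H.β i ^ 2 = 1 := by rw [h0] at hn; linarith
    simp [pairEntanglement, this, h0]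
  · have : H.α i ^ 2 = 1 := by rw [h0] at hn; linarith
    simp [pairEntanglement, this, h0]

/-! ### Partner pairs and the upper bound -/

/-- The pair obtained from a pair by flipping the bits in laboratory `p`. -/
def flipPair (C : SpatialConfiguration N) (p : Fin C.labs) (i : Fin (2 ^ (N - 1))) :
    Fin (2 ^ (N - 1)) := H.pairIndex (C.flip p (H.k i))

lemma flipPair_involutive (C : SpatialConfiguration N) (p : Fin C.labs) :
    Function.Involutive (H.flipPair C p) := by
  intro i
  rcases H.eq_k_or_eq_compl (C.flip p (H.k i)) with h | h
  · rw [flipPair, flipPair, ← h, C.flip_flip, pairIndex_k]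
  · have h' : H.k (H.flipPair C p i) = (C.flip p (H.k i)).compl := by
      rw [h, BitString.compl_compl]; rfl
    rw [flipPair, h', C.flip_compl, C.flip_flip, pairIndex_compl, pairIndex_k]

/-- Spatial separation enters here: laboratory `p` holds a qubit, and so does another one, so the
flip is neither trivial nor the full complement. -/
lemma flipPair_ne (C : SpatialConfiguration N) (p : Fin C.labs) (i : Fin (2 ^ (N - 1))) :
    H.flipPair C p i ≠ i := by
  intro h
  rcases H.eq_k_or_eq_compl (C.flip p (H.k i)) with h' | h' <;>
    rw [show H.pairIndex (C.flip p (H.k i)) = i from h] at h'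
  · exact C.flip_ne p _ h'
  · exact C.flip_ne_compl p _ h'

/-- If both states of an entangled pair belong to a perfectly distinguishable set, then no state
of the pair with the bits of one laboratory flipped does. -/
lemma state_flipPair_notMem {S : Set (StateVector N)} (hS : S ⊆ H.states)
    {C : SpatialConfiguration N} (hC : PerfectlyLOCCDistinguishable C S) (p : Fin C.labs)
    {i : Fin (2 ^ (N - 1))} (hi : i ∈ H.ent) (hiS : ∀ s, H.state i s ∈ S) (t : Bool) :
    H.state (H.flipPair C p i) t ∉ S := by
  classical
  intro htS
  obtain ⟨L, _, g, h, hflip, hid, hdist⟩ := hC.exists_functionals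
  have hsupp : ∀ φ ∈ S, ∀ l, g l ≠ φ → h l ⬝ᵥ φ = 0 := by
    intro φ hφ l hl
    refine dotProduct_eq_zero_of_guess_ne ?_ (hdist φ hφ) l hl
    obtain ⟨j, s, rfl⟩ := hS hφ
    rw [hid, H.dotProduct_star_state]
  obtain ⟨hα, hβ⟩ := H.α_ne_zero_and_β_ne_zero hi
  have hαc : (H.α i : ℂ) ≠ 0 := by exact_mod_cast hα
  have hβc : (H.β i : ℂ) ≠ 0 := by exact_mod_cast hβ
  have hnorm : ((H.α i : ℂ)) ^ 2 + (H.β i : ℂ) ^ 2 = 1 := by exact_mod_cast H.normalized i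
  have hij := H.flipPair_ne C p i
  set j := H.flipPair C p i with hj
  have hprod (l : L) : h l (H.k j) * h l (H.k j).compl = h l (H.k i) * h l (H.k i).compl := by
    rw [hflip l p (H.k i)]
    rcases H.eq_k_or_eq_compl (C.flip p (H.k i)) with e | e <;>
      rw [show H.pairIndex (C.flip p (H.k i)) = j from rfl] at e <;> rw [e]
    rw [BitString.compl_compl, mul_comm]
  have hne (s : Bool) : H.state i s ≠ H.state j t := fun e =>
    hij (congrArg Prod.fst (H.state_inj e)).symm
  -- Such a functional annihilates `ψᵢ⁺` and `ψᵢ⁻`, which span `|kᵢ⟩` and its complement.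
  have hzero (l : L) (hl : g l = H.state j t) : h l (H.k j) * h l (H.k j).compl = 0 := by
    have e1 := hsupp _ (hiS true) l (hl.trans_ne (hne true).symm)
    have e2 := hsupp _ (hiS false) l (hl.trans_ne (hne false).symm)
    rw [dotProduct_state] at e1 e2
    simp only [if_true, Bool.false_eq_true, if_false] at e1 e2
    have : h l (H.k i) = 0 := by
      linear_combination (H.α i : ℂ) * e1 + (H.β i : ℂ) * e2 - h l (H.k i) * hnorm
    rw [hprod, this, zero_mul]
  obtain ⟨l, hl, hl'⟩ : ∃ l, g l = H.state i true ∧ h l ⬝ᵥ H.state i true ≠ 0 := by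
    by_contra! hcon
    have := hdist _ (hiS true)
    rw [Finset.sum_eq_zero] at this
    · exact zero_ne_one this
    · intro l _
      split_ifs with hl
      · rw [hcon l hl, zero_mul]
      · rfl
  -- Annihilating `ψᵢ⁻` means `β h(k) = α h(k̄)`; with `α, β ≠ 0` one zero amplitude would force the
  -- other, and then `ψᵢ⁺` would be annihilated too.
  have hnonzero : h l (H.k j) * h l (H.k j).compl ≠ 0 := by
    have e2 := hsupp _ (hiS false) l (hl.trans_ne fun e => by
      simpa using H.state_inj e)
    rw [dotProduct_state] at e2 hl'
    simp only [if_true, Bool.false_eq_true, if_false] at e2 hl'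
    rw [hprod]
    intro h0
    apply hl'
    rcases mul_eq_zero.1 h0 with h0 | h0 <;> rw [h0] at e2 ⊢
    · have : h l (H.k i).compl = 0 := by simpa [hαc] using e2
      simp [this]
    · have : h l (H.k i) = 0 := by simpa [hβc] using e2
      simp [this]
  have hlne : g l ≠ H.state j t := hl.trans_ne (hne true)
  -- The partner may be a product pair, so only one nonzero coefficient is guaranteed; it selects
  -- the string `m`.
  obtain ⟨x, y, hxy, hxy0⟩ : ∃ x y : ℂ,
      H.state j t = x • ket (H.k j) + y • ket (H.k j).compl ∧ (x ≠ 0 ∨ y ≠ 0) := by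
    have hj0 : (H.α j : ℂ) ≠ 0 ∨ (H.β j : ℂ) ≠ 0 := by
      by_contra! h0
      have : ((H.α j : ℂ)) ^ 2 + (H.β j : ℂ) ^ 2 = 1 := by exact_mod_cast H.normalized j
      simp [h0.1, h0.2] at this
    cases t
    · exact ⟨H.β j, -H.α j, by simp [state, sub_eq_add_neg], by simpa [or_comm] using hj0⟩
    · exact ⟨H.α j, H.β j, by simp [state], hj0⟩
  rcases hxy0 with hx | hy
  · exact hnonzero (by rw [apply_eq_zero_of_guess_ne hid (hsupp _ htS) (H.k_compl_ne j) hxy hx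
      hzero l hlne, zero_mul])
  · rw [add_comm] at hxy
    exact hnonzero (by rw [apply_eq_zero_of_guess_ne hid (hsupp _ htS) (H.k_compl_ne j).symm hxy hy
      (fun l hl => by rw [mul_comm]; exact hzero l hl) l hlne, mul_zero])

lemma ncard_setOf_eq_sum {n : ℕ} (A : Set (Fin n × Bool)) [DecidablePred (· ∈ A)] :
    A.ncard = ∑ i, ((if (i, true) ∈ A then 1 else 0) + if (i, false) ∈ A then 1 else 0) := by
  have h : A.toFinset = Finset.univ.filter (· ∈ A) := by ext; simp
  rw [Set.ncard_eq_toFinset_card', h, Finset.card_filter, Fintype.sum_prod_type]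
  exact Finset.sum_congr rfl fun i _ => Fintype.sum_bool _

/-- A perfectly distinguishable set of basis states misses at least `K` states. -/
theorem ncard_le_of_perfectlyLOCCDistinguishable (hN : 1 ≤ N) {S : Set (StateVector N)}
    (hS : S ⊆ H.states) {C : SpatialConfiguration N} (hC : PerfectlyLOCCDistinguishable C S) :
    S.ncard ≤ 2 ^ N - K := by
  classical
  let p : Fin C.labs := ⟨0, by have := C.two_le_labs; omega⟩
  -- The excess of a pair over its allowance: 2 states, or 1 if entangled. It is positive (equal to
  -- 1) only for an entangled pair wholly in `S`, and then the partner has at most `0 + 1 - 2 = -1`.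
  let c : Fin (2 ^ (N - 1)) → ℤ := fun i =>
    (if H.state i true ∈ S then 1 else 0) + (if H.state i false ∈ S then 1 else 0) +
      (if i ∈ H.ent then 1 else 0) - 2
  have hc (i) : c i + c (H.flipPair C p i) ≤ 0 := by
    have key (i) (hi : 0 < c i) : c i + c (H.flipPair C p i) ≤ 0 := by
      have h3 : H.state i true ∈ S ∧ H.state i false ∈ S ∧ i ∈ H.ent := by
        by_contra hcon
        simp only [c] at hi
        split_ifs at hi <;> simp_all
      have hn := H.state_flipPair_notMem hS hC p h3.2.2 (by rintro (_ | _); exacts [h3.2.1, h3.1])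
      simp only [c, h3, hn, if_true, if_false]
      split_ifs <;> norm_num
    rcases lt_or_ge 0 (c i) with h | h
    · exact key i h
    rcases lt_or_ge 0 (c (H.flipPair C p i)) with h' | h'
    · have := key _ h'
      rw [H.flipPair_involutive C p i] at this
      linarith
    · linarith
  have hsum : 2 * ∑ i, c i ≤ 0 := by
    have e : ∑ i, c (H.flipPair C p i) = ∑ i, c i :=
      Equiv.sum_comp (H.flipPair_involutive C p).toPerm c
    calc 2 * ∑ i, c i = ∑ i, (c i + c (H.flipPair C p i)) := by
          rw [Finset.sum_add_distrib, e]; ring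
      _ ≤ 0 := Finset.sum_nonpos fun i _ => hc i
  have hcount : ∑ i, c i = S.ncard + K - 2 ^ N := by
    have hpow : (2 : ℤ) ^ N = 2 ^ (N - 1) * 2 := by rw [← pow_succ]; congr 1; omega
    rw [H.ncard_eq_of_states hS, ncard_setOf_eq_sum]
    simp only [c, Finset.sum_sub_distrib, Finset.sum_add_distrib, Set.mem_ofPred_eq, hpow]
    have hK : (∑ i, if i ∈ H.ent then (1 : ℤ) else 0) = K := by
      simp [H.card_ent]
    rw [hK]
    push_cast
    simp
  have : (S.ncard : ℤ) + K ≤ (2 ^ N : ℕ) := by push_cast; linarith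
  omega

/-! ### Tightness -/

lemma productsAndOneOfEachPair_subset (σ : Fin (2 ^ (N - 1)) → Bool) :
    H.productsAndOneOfEachPair σ ⊆ H.states := by
  rintro φ ⟨i, s, -, rfl⟩
  exact ⟨i, s, rfl⟩

lemma ncard_productsAndOneOfEachPair (hN : 1 ≤ N) (σ : Fin (2 ^ (N - 1)) → Bool) :
    (H.productsAndOneOfEachPair σ).ncard = 2 ^ N - K := by
  classical
  have hset : {x : Fin (2 ^ (N - 1)) × Bool | H.state x.1 x.2 ∈ H.productsAndOneOfEachPair σ} =
      {x | x.1 ∈ H.ent → x.2 = σ x.1} := by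
    ext ⟨i, s⟩
    constructor
    · rintro ⟨j, t, h, e⟩
      cases H.state_inj e
      exact h
    · intro h
      exact ⟨i, s, h, rfl⟩
  rw [H.ncard_eq_of_states (H.productsAndOneOfEachPair_subset σ), hset, ncard_setOf_eq_sum]
  have hpow : 2 ^ N = 2 ^ (N - 1) * 2 := by rw [← pow_succ]; congr 1; omega
  have hpt (i : Fin (2 ^ (N - 1))) :
      ((if (i, true) ∈ {x : Fin (2 ^ (N - 1)) × Bool | x.1 ∈ H.ent → x.2 = σ x.1} then 1 else 0) +
      if (i, false) ∈ {x : Fin (2 ^ (N - 1)) × Bool | x.1 ∈ H.ent → x.2 = σ x.1} then 1 else 0) +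
      (if i ∈ H.ent then 1 else 0) = 2 := by
    simp only [Set.mem_ofPred_eq]
    by_cases hi : i ∈ H.ent <;> rcases Bool.eq_false_or_eq_true (σ i) with hσ | hσ <;>
      simp [hi, hσ]
  have hsum := Finset.sum_congr (rfl : (Finset.univ : Finset (Fin (2 ^ (N - 1)))) = Finset.univ)
    fun i _ => hpt i
  rw [Finset.sum_add_distrib] at hsum
  have hK : (∑ i, if i ∈ H.ent then 1 else 0) = K := by
    simp [H.card_ent]
  rw [hK] at hsum
  simp only [Finset.sum_const, Finset.card_univ, Fintype.card_fin, smul_eq_mul] at hsum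
  omega

/-- All product states and one state of each entangled pair are distinguished by measuring every
laboratory in the computational basis. -/
theorem perfectlyLOCCDistinguishable_productsAndOneOfEachPair (C : SpatialConfiguration N)
    (σ : Fin (2 ^ (N - 1)) → Bool) :
    PerfectlyLOCCDistinguishable C (H.productsAndOneOfEachPair σ) := by
  classical
  let guess : (∀ p, C.LocalIndex (fun _ => 0) p) → StateVector N := fun x =>
    H.state (H.pairIndex (C.bits x)) (if H.pairIndex (C.bits x) ∈ H.ent then
      σ (H.pairIndex (C.bits x)) else (H.pairEquiv.symm (C.bits x)).2)
  have hguess (k : BitString N) (i : Fin (2 ^ (N - 1))) (s : Bool) (hs : i ∈ H.ent → s = σ i)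
      (hk : H.state i s k ≠ 0) : guess (C.embed _ k) = H.state i s := by
    have hi : H.pairIndex k = i := by
      by_contra hi
      exact hk (H.state_apply_of_pairIndex_ne hi s)
    simp only [guess, C.bits_embed, hi]
    split_ifs with hent
    · rw [hs hent]
    · congr 1
      have hβ := H.product i hent
      rcases H.eq_k_or_eq_compl k with e | e <;> rw [hi] at e
      · have : k = H.pairEquiv (i, true) := e
        rw [e, state_apply_k] at hk
        rw [this, Equiv.symm_apply_apply]
        cases s
        · simp [hβ] at hk
        · rfl
      · have : k = H.pairEquiv (i, false) := e
        rw [e, state_apply_k_compl] at hk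
        rw [this, Equiv.symm_apply_apply]
        cases s
        · rfl
        · simp [hβ] at hk
  -- Ancillas are one-dimensional, and the initial record is arbitrary because every laboratory
  -- overwrites its entry.
  refine ⟨fun _ => 0, LOCCProtocol.measureAll guess Finset.univ.toList fun _ => (fun _ => false, 0),
    ?_⟩
  rintro φ ⟨i, s, hs, rfl⟩
  rw [LOCCProtocol.prob_measureAll]
  simp only [Finset.mem_toList, Finset.mem_univ, if_true]
  rw [C.sum_eq_sum_embed _ fun x hx => by
    simp [Matrix.vecMulVec_apply, SpatialConfiguration.distribute, hx]]
  rw [← H.dotProduct_star_state i s, dotProduct]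
  refine Finset.sum_congr rfl fun k _ => ?_
  simp only [Matrix.vecMulVec_apply, Pi.star_apply, C.distribute_embed]
  by_cases hk : H.state i s k = 0
  · simp [hk]
  · rw [if_pos (hguess k i s hs hk)]

end HybridBasis

end

theorem theorem3 (N K : ℕ) (hN : 2 ≤ N) (hK : K < 2 ^ (N - 1)) (H : HybridBasis N K) :
    (∀ S : Set (StateVector N), S ⊆ H.states →
      (∃ C : SpatialConfiguration N, PerfectlyLOCCDistinguishable C S) →
        S.ncard ≤ 2 ^ N - K) ∧
    (∀ σ : Fin (2 ^ (N - 1)) → Bool,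
      H.productsAndOneOfEachPair σ ⊆ H.states ∧
      (H.productsAndOneOfEachPair σ).ncard = 2 ^ N - K ∧
      ∀ C : SpatialConfiguration N,
        PerfectlyLOCCDistinguishable C (H.productsAndOneOfEachPair σ)) := by
  have hN' : 1 ≤ N := by omega
  refine ⟨fun S hS ⟨C, hC⟩ => H.ncard_le_of_perfectlyLOCCDistinguishable hN' hS hC, fun σ =>
    ⟨H.productsAndOneOfEachPair_subset σ, H.ncard_productsAndOneOfEachPair hN' σ, fun C =>
      H.perfectlyLOCCDistinguishable_productsAndOneOfEachPair C σ⟩⟩
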